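/- For every integer $N\ge 2$ fix $\alpha_N\in(0,1)$ and $m_N\in\{1,\dots,N-1\}$, and put $n_N=N-m_N$. Place $N$ balls in two urns; $n_N$ of them are regular and $m_N$ are heavy. Each ball is selected at the times of an independent Poisson process, of rate $1$ for a regular ball and of rate $\alpha_N$ for a heavy one, and a selected ball is moved to one of the two urns according to an independent fair coin toss. Let $(R_t,H_t)_{t\ge 0}$ be the continuous-time Markov chain on $\mathcal X_N=\{0,\dots,n_N\}\times\{0,\dots,m_N\}$ recording the numbers of regular and of heavy balls in the left urn. Its stationary distribution is $\chi_\star(a,b)=2^{-N}\binom{n_N}{a}\binom{m_N}{b}$. Write $\chi_t^{r,h}$ for the law of $(R_t,H_t)$ when $(R_0,H_0)=(r,h)$, and set $$\widetilde{\mathcal D}_N(t)=\max_{(r,h)\in\mathcal X_N}\tfrac12\sum_{(a,b)\in\mathcal X_N}\bigl|\chi_t^{r,h}(a,b)-\chi_\star(a,b)\bigr|,\qquad t_{\rm mix}^{(N)}(\varepsilon)=\inf\{t\ge 0:\widetilde{\mathcal D}_N(t)\le\varepsilon\},\qquad t_{\rm mix}^{(N)}=t_{\rm mix}^{(N)}(\tfrac14).$$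 Let $t_{\rm rel}^{(N)}$ be the relaxation time of the chain, that is, the inverse of the smallest nonzero eigenvalue of minus its generator. Assume that the limit $$\lim_{N\to\infty}\left(\frac{\log m_N}{\log N}-\alpha_N\right)\in[-1,1]$$ exists. Then $t_{\rm rel}^{(N)}=\alpha_N^{-1}$ for every $N\ge2$, and the sequence of chains exhibits cutoff, that is, $$\lim_{N\to\infty}\frac{t_{\rm mix}^{(N)}(\varepsilon)}{t_{\rm mix}^{(N)}(1-\varepsilon)}=1\qquad\text{for every }\varepsilon\in(0,1),$$ if and only if the product condition $$\lim_{N\to\infty}\frac{t_{\rm mix}^{(N)}}{t_{\rm rel}^{(N)}}=\infty$$ holds. -/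

import Mathlib

open Filter Topology

noncomputable section

namespace Ehrenfest

/-- The states `(a, b)`: `a` of the `n` regular balls and `b` of the `m` heavy balls are in the
left urn. -/
abbrev State (n m : ℕ) : Type := Fin (n + 1) × Fin (m + 1)

/-- Rate at which the number of balls in the left urn jumps from `i` to `j`, for a class of `k`
balls, each selected at rate `ρ` and then placed in one of the two urns by a fair coin toss. -/
def jumpRate (k : ℕ) (ρ : ℝ) (i j : ℕ) : ℝ :=
  if j = i + 1 then ρ * ((k : ℝ) - (i : ℝ)) / 2
  else if i = j + 1 then ρ * (i : ℝ) / 2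
  else 0

/-- Jump rates of `(R_t, H_t)`: the two classes of balls evolve independently, the regular balls
being selected at rate `1` and the heavy ones at rate `α`. -/
def rate (n m : ℕ) (α : ℝ) (x y : State n m) : ℝ :=
  (if x.2 = y.2 then jumpRate n 1 x.1 y.1 else 0) +
    (if x.1 = y.1 then jumpRate m α x.2 y.2 else 0)

/-- The infinitesimal generator (`Q`-matrix) of `(R_t, H_t)`. -/
def generator (n m : ℕ) (α : ℝ) : Matrix (State n m) (State n m) ℝ :=
  Matrix.of fun x y => if x = y then -∑ z, rate n m α x z else rate n m α x y

/-- `law n m α t x y` is the probability that the chain started at `x` is at `y` at time `t`. -/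
def law (n m : ℕ) (α t : ℝ) (x y : State n m) : ℝ :=
  NormedSpace.exp (t • generator n m α) x y

/-- The stationary distribution: a product of two symmetric binomial laws. -/
def stationary (n m : ℕ) (y : State n m) : ℝ :=
  ((n.choose y.1 : ℝ) / 2 ^ n) * ((m.choose y.2 : ℝ) / 2 ^ m)

/-- Total variation distance of two probability mass functions on a finite set. -/
def tvDist {ι : Type*} [Fintype ι] (p q : ι → ℝ) : ℝ := (1 / 2) * ∑ y, |p y - q y|

/-- Worst-case (over the starting state) total variation distance to equilibrium at time `t`. -/
def distToEq (n m : ℕ) (α t : ℝ) : ℝ :=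
  Finset.univ.sup' Finset.univ_nonempty
    fun x : State n m => tvDist (law n m α t x) (stationary n m)

/-- First time `t ≥ 0` at which the distance to equilibrium `D` is at most `ε`. -/
def mixingTime (D : ℝ → ℝ) (ε : ℝ) : ℝ := sInf {t : ℝ | 0 ≤ t ∧ D t ≤ ε}

/-- The smallest nonzero eigenvalue of `-Q`, for `Q` the generator of an irreducible reversible
chain (its eigenvalues are real and nonpositive). -/
def spectralGap {ι : Type*} [Fintype ι] [DecidableEq ι] (Q : Matrix ι ι ℝ) : ℝ :=
  sInf {c : ℝ | 0 < c ∧ Module.End.HasEigenvalue (Matrix.toLin' (-Q)) c}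

/-- The relaxation time: the inverse of the spectral gap. -/
def relaxationTime {ι : Type*} [Fintype ι] [DecidableEq ι] (Q : Matrix ι ι ℝ) : ℝ :=
  (spectralGap Q)⁻¹

/-- Cutoff for a sequence of chains with distances to equilibrium `D N`. -/
def HasCutoff (D : ℕ → ℝ → ℝ) : Prop :=
  ∀ ε : ℝ, 0 < ε → ε < 1 →
    Tendsto (fun N => mixingTime (D N) ε / mixingTime (D N) (1 - ε)) atTop (𝓝 1)

end Ehrenfest

end

/-! The product condition says `α * t_mix → ∞`, because `t_rel = 1/α`. The main estimate is `α *
t_mix(ε) = α * cutoffTime + O_ε(1)`, uniformly in `n, m ≥ 1` and `0 < α ≤ 1`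
(`exists_abs_mixingTime_sub_le`). Upper half: the chain is the image of independent labelled balls
(`law_project`), whose kernel is a product with explicit `L²` distance to uniform. Lower half:
linear eigenfunctions and the second moment method. If `α * t_mix(1/4) → ∞`, the `O(1)` differences
between levels are negligible, and cutoff follows. Conversely the distance is at least `exp (-α t) /
2`, so `α * t_mix(ε) ≥ log (1 / (2 ε))`. Cutoff makes all levels comparable up to a factor 2, so
letting `ε → 0` sends `α * t_mix(1/4)` to infinity. For `t_rel`, the heavy linear function has rate
`α`, and no rate is smaller since all laws converge at speed `exp (-α t)`. -/

namespace Ehrenfest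

/-! ### Differential equations for the matrix semigroup. -/

section MatrixExp

variable {ι : Type*} [Fintype ι] [DecidableEq ι]

attribute [local instance] Matrix.linftyOpNormedRing Matrix.linftyOpNormedAlgebra in
theorem hasDerivAt_exp_smul_entry_left (Q : Matrix ι ι ℝ) (t : ℝ) (x y : ι) :
    HasDerivAt (fun s : ℝ => NormedSpace.exp (s • Q) x y)
      (∑ z, Q x z * NormedSpace.exp (t • Q) z y) t := by
  have h : HasDerivAt (fun s : ℝ => NormedSpace.exp (s • Q)) (Q * NormedSpace.exp (t • Q)) t :=
    hasDerivAt_exp_smul_const' Q t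
  have h2 := hasDerivAt_pi.1 (hasDerivAt_pi.1 h x) y
  simpa [Matrix.mul_apply] using h2

attribute [local instance] Matrix.linftyOpNormedRing Matrix.linftyOpNormedAlgebra in
theorem hasDerivAt_exp_smul_entry_right (Q : Matrix ι ι ℝ) (t : ℝ) (x y : ι) :
    HasDerivAt (fun s : ℝ => NormedSpace.exp (s • Q) x y)
      (∑ z, NormedSpace.exp (t • Q) x z * Q z y) t := by
  have h : HasDerivAt (fun s : ℝ => NormedSpace.exp (s • Q)) (NormedSpace.exp (t • Q) * Q) t :=
    hasDerivAt_exp_smul_const Q t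
  have h2 := hasDerivAt_pi.1 (hasDerivAt_pi.1 h x) y
  simpa [Matrix.mul_apply] using h2

/-- By the forward equation, `exp (-c s) * (exp (s Q) f) x` has zero derivative in `s`. -/
theorem exp_smul_apply_eigenfunction (Q : Matrix ι ι ℝ) (f : ι → ℝ) (c : ℝ)
    (hf : ∀ x, ∑ y, Q x y * f y = c * f x) (t : ℝ) (x : ι) :
    ∑ y, NormedSpace.exp (t • Q) x y * f y = Real.exp (c * t) * f x := by
  have hd : ∀ s : ℝ, HasDerivAt
      (fun s : ℝ => Real.exp (-(c * s)) * ∑ y, NormedSpace.exp (s • Q) x y * f y) 0 s := by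
    intro s
    have h1 : HasDerivAt (fun s : ℝ => ∑ y, NormedSpace.exp (s • Q) x y * f y)
        (∑ y, (∑ z, NormedSpace.exp (s • Q) x z * Q z y) * f y) s :=
      HasDerivAt.fun_sum fun y _ => (hasDerivAt_exp_smul_entry_right Q s x y).mul_const _
    have h2 : HasDerivAt (fun s : ℝ => Real.exp (-(c * s))) (Real.exp (-(c * s)) * (-(c * 1))) s :=
      (((hasDerivAt_id s).const_mul c).neg).exp
    have h3 : ∑ y, (∑ z, NormedSpace.exp (s • Q) x z * Q z y) * f y
        = c * ∑ y, NormedSpace.exp (s • Q) x y * f y := by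
      simp only [Finset.sum_mul]
      rw [Finset.sum_comm, Finset.mul_sum]
      refine Finset.sum_congr rfl fun z _ => ?_
      have := hf z
      simp only [mul_assoc, ← Finset.mul_sum, this]
      ring
    rw [h3] at h1
    refine (h2.mul h1).congr_deriv ?_
    ring
  have hc := is_const_of_deriv_eq_zero (fun s => (hd s).differentiableAt)
    (fun s => (hd s).deriv) t 0
  have h0 : ∑ y, NormedSpace.exp ((0 : ℝ) • Q) x y * f y = f x := by
    simp [Matrix.one_apply]
  simp only [h0, mul_zero, neg_zero, Real.exp_zero, one_mul] at hc
  rw [← hc, ← mul_assoc, ← Real.exp_add]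
  simp

end MatrixExp

/-! ### Independent labelled balls on the cube. -/

section Cube

variable {ι : Type*} [Fintype ι] [DecidableEq ι]

/-- The spin of an urn label. -/
noncomputable def spin (b : Bool) : ℝ := if b then 1 else -1

theorem spin_not (b : Bool) : spin (!b) = -spin b := by cases b <;> simp [spin]

/-- Move the ball `i` to the other urn. -/
def toggle (x : ι → Bool) (i : ι) : ι → Bool := Function.update x i (!x i)

theorem toggle_self {ι : Type*} [DecidableEq ι] (x : ι → Bool) (i : ι) :
    toggle x i i = !x i := by
  simp [toggle]

theorem toggle_of_ne {ι : Type*} [DecidableEq ι] {x : ι → Bool} {i j : ι} (h : j ≠ i) :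
    toggle x i j = x j := by
  simp [toggle, h]

theorem toggle_toggle {ι : Type*} [DecidableEq ι] (x : ι → Bool) (i : ι) : toggle (toggle x i) i = x := by
  simp [toggle]

/-- Transition probability of a single ball selected at rate `r`. -/
noncomputable def ballKernel (r t : ℝ) (a b : Bool) : ℝ := (1 + Real.exp (-(r * t)) * (spin a * spin b)) / 2

/-- Transition kernel of independent labelled balls. -/
noncomputable def cubeKernel (ρ : ι → ℝ) (t : ℝ) (x z : ι → Bool) : ℝ := ∏ i, ballKernel (ρ i) t (x i) (z i)

theorem ballKernel_nonneg {r t : ℝ} (h : 0 ≤ r * t) (a b : Bool) : 0 ≤ ballKernel r t a b := by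
  have h1 : Real.exp (-(r * t)) ≤ 1 := Real.exp_le_one_iff.2 (by linarith)
  have h2 := Real.exp_pos (-(r * t))
  cases a <;> cases b <;> simp [ballKernel, spin] <;> linarith

omit [DecidableEq ι] in
theorem cubeKernel_nonneg {ρ : ι → ℝ} (hρ : ∀ i, 0 ≤ ρ i) {t : ℝ} (ht : 0 ≤ t)
    (x z : ι → Bool) : 0 ≤ cubeKernel ρ t x z :=
  Finset.prod_nonneg fun i _ => ballKernel_nonneg (mul_nonneg (hρ i) ht) _ _

theorem sum_cubeKernel (ρ : ι → ℝ) (t : ℝ) (x : ι → Bool) : ∑ z, cubeKernel ρ t x z = 1 := by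
  unfold cubeKernel
  rw [← Fintype.prod_sum fun i b => ballKernel (ρ i) t (x i) b]
  refine Finset.prod_eq_one fun i _ => ?_
  rw [Fintype.sum_bool]
  simp only [ballKernel, spin]
  cases x i <;> simp <;> ring

theorem sum_cubeKernel_sq (ρ : ι → ℝ) (t : ℝ) (x : ι → Bool) :
    ∑ z, cubeKernel ρ t x z ^ 2 = ∏ i, ((1 + Real.exp (-(ρ i * t)) ^ 2) / 2) := by
  unfold cubeKernel
  simp only [← Finset.prod_pow]
  rw [← Fintype.prod_sum fun i b => ballKernel (ρ i) t (x i) b ^ 2]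
  refine Finset.prod_congr rfl fun i _ => ?_
  rw [Fintype.sum_bool]
  simp only [ballKernel, spin]
  cases x i <;> simp <;> ring

omit [DecidableEq ι] in
theorem cubeKernel_zero (ρ : ι → ℝ) (x z : ι → Bool) :
    cubeKernel ρ 0 x z = if x = z then 1 else 0 := by
  unfold cubeKernel
  have h : ∀ i, ballKernel (ρ i) 0 (x i) (z i) = if x i = z i then 1 else 0 := by
    intro i
    unfold ballKernel
    cases x i <;> cases z i <;> norm_num [spin]
  simp only [h]
  rw [Finset.prod_ite_zero]
  simp [funext_iff]

theorem cubeKernel_toggle (ρ : ι → ℝ) (t : ℝ) (x z : ι → Bool) (i : ι) :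
    cubeKernel ρ t x (toggle z i) =
      (∏ j ∈ Finset.univ.erase i, ballKernel (ρ j) t (x j) (z j)) *
        ballKernel (ρ i) t (x i) (!z i) := by
  unfold cubeKernel
  rw [← Finset.prod_erase_mul _ _ (Finset.mem_univ i)]
  congr 1
  · refine Finset.prod_congr rfl fun j hj => ?_
    simp [toggle, Finset.ne_of_mem_erase hj]
  · simp [toggle]

/-- Forward equation: a selected ball changes urn with probability one half, hence toggles at rate
`ρ i / 2`. -/
theorem hasDerivAt_cubeKernel (ρ : ι → ℝ) (t : ℝ) (x z : ι → Bool) :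
    HasDerivAt (fun s => cubeKernel ρ s x z)
      (∑ i, ρ i / 2 * (cubeKernel ρ t x (toggle z i) - cubeKernel ρ t x z)) t := by
  have hb : ∀ i ∈ (Finset.univ : Finset ι),
      HasDerivAt (fun s => ballKernel (ρ i) s (x i) (z i))
      (ρ i / 2 * (ballKernel (ρ i) t (x i) (!z i) - ballKernel (ρ i) t (x i) (z i))) t := by
    intro i _
    have h2 : HasDerivAt (fun s : ℝ => Real.exp (-(ρ i * s)))
        (Real.exp (-(ρ i * t)) * (-(ρ i * 1))) t :=
      (((hasDerivAt_id t).const_mul (ρ i)).neg).exp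
    refine (((h2.mul_const (spin (x i) * spin (z i))).const_add 1).div_const 2).congr_deriv ?_
    rw [ballKernel, ballKernel, spin_not]
    ring
  have h := HasDerivAt.fun_finsetProd hb
  refine h.congr_deriv (Finset.sum_congr rfl fun i _ => ?_)
  rw [cubeKernel_toggle, cubeKernel, ← Finset.prod_erase_mul _ _ (Finset.mem_univ i), smul_eq_mul]
  ring

theorem sum_cubeKernel_toggle (ρ : ι → ℝ) (t : ℝ) (x : ι → Bool) (i : ι) (g : (ι → Bool) → ℝ) :
    ∑ z, cubeKernel ρ t x (toggle z i) * g z = ∑ z, cubeKernel ρ t x z * g (toggle z i) := by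
  have hinv : Function.Involutive fun z : ι → Bool => toggle z i := fun z => toggle_toggle z i
  rw [← Equiv.sum_comp hinv.toPerm fun z => cubeKernel ρ t x z * g (toggle z i)]
  simp [toggle_toggle]

/-- Toggling is an involution, so the labelled generator is symmetric and can be moved onto the test
function. -/
theorem sum_deriv_cubeKernel (ρ : ι → ℝ) (t : ℝ) (x : ι → Bool) (g : (ι → Bool) → ℝ) :
    ∑ z, (∑ i, ρ i / 2 * (cubeKernel ρ t x (toggle z i) - cubeKernel ρ t x z)) * g z =
      ∑ z, cubeKernel ρ t x z * ∑ i, ρ i / 2 * (g (toggle z i) - g z) := by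
  simp only [Finset.sum_mul, Finset.mul_sum]
  rw [Finset.sum_comm]
  conv_rhs => rw [Finset.sum_comm]
  refine Finset.sum_congr rfl fun i _ => ?_
  have h := sum_cubeKernel_toggle ρ t x i g
  calc _ = ρ i / 2 * (∑ z, cubeKernel ρ t x (toggle z i) * g z - ∑ z, cubeKernel ρ t x z * g z) := by
        rw [← Finset.sum_sub_distrib, Finset.mul_sum]
        exact Finset.sum_congr rfl fun z _ => by ring
    _ = _ := by
        rw [h, ← Finset.sum_sub_distrib, Finset.mul_sum]
        exact Finset.sum_congr rfl fun z _ => by ring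

/-- Cauchy-Schwarz bound of the `L¹` distance of the cube kernel to the uniform law. -/
theorem sum_abs_cubeKernel_sub_le (ρ : ι → ℝ) (t : ℝ) (x : ι → Bool) :
    ∑ z, |cubeKernel ρ t x z - 1 / 2 ^ Fintype.card ι| ≤
      √(Real.exp (∑ i, Real.exp (-(ρ i * t)) ^ 2) - 1) := by
  refine Real.le_sqrt_of_sq_le ?_
  have hc : (Finset.univ : Finset (ι → Bool)).card = 2 ^ Fintype.card ι := by simp
  have hcs := sq_sum_le_card_mul_sum_sq (s := (Finset.univ : Finset (ι → Bool)))
    (f := fun z => |cubeKernel ρ t x z - 1 / 2 ^ Fintype.card ι|)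
  refine hcs.trans ?_
  simp only [sq_abs, sub_sq, Finset.sum_add_distrib, Finset.sum_sub_distrib, sum_cubeKernel_sq]
  rw [← Finset.sum_mul, ← Finset.mul_sum, sum_cubeKernel, Finset.sum_const, hc, nsmul_eq_mul]
  have hp : (0 : ℝ) < 2 ^ Fintype.card ι := by positivity
  have h1 : ∏ i, ((1 + Real.exp (-(ρ i * t)) ^ 2) / 2) =
      (∏ i, (1 + Real.exp (-(ρ i * t)) ^ 2)) / 2 ^ Fintype.card ι := by
    rw [Finset.prod_div_distrib]; simp
  have h2 : ∏ i, (1 + Real.exp (-(ρ i * t)) ^ 2) ≤ Real.exp (∑ i, Real.exp (-(ρ i * t)) ^ 2) := by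
    rw [Real.exp_sum]
    refine Finset.prod_le_prod (fun i _ => by positivity) fun i _ => ?_
    have := Real.add_one_le_exp (Real.exp (-(ρ i * t)) ^ 2)
    linarith
  rw [h1]
  push_cast
  have h3 : (2 : ℝ) ^ Fintype.card ι * ((∏ i, (1 + Real.exp (-(ρ i * t)) ^ 2)) / 2 ^ Fintype.card ι
      - 2 * 1 * (1 / 2 ^ Fintype.card ι) + 2 ^ Fintype.card ι * (1 / 2 ^ Fintype.card ι) ^ 2)
      = ∏ i, (1 + Real.exp (-(ρ i * t)) ^ 2) - 1 := by
    generalize ∏ i, (1 + Real.exp (-(ρ i * t)) ^ 2) = P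
    field_simp
    ring
  rw [h3]
  linarith

end Cube

/-! ### Lumping labelled balls into urn counts. -/

section Projection

/-- The number of balls in the left urn. -/
def leftCount {k : ℕ} (x : Fin k → Bool) : Fin (k + 1) :=
  ⟨(Finset.univ.filter fun i => x i = true).card,
    Nat.lt_succ_of_le ((Finset.card_le_univ _).trans (by simp))⟩

theorem leftCount_toggle {k : ℕ} (x : Fin k → Bool) (i : Fin k) :
    (leftCount (toggle x i) : ℕ) =
      if x i = true then (leftCount x : ℕ) - 1 else (leftCount x : ℕ) + 1 := by
  unfold leftCount
  split_ifs with h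
  · have : (Finset.univ.filter fun j => toggle x i j = true) =
        (Finset.univ.filter fun j => x j = true).erase i := by
      ext j
      by_cases hj : j = i
      · subst hj; simp [toggle_self, h]
      · simp [toggle_of_ne hj, hj]
    simp only [this]
    rw [Finset.card_erase_of_mem (by simp [h])]
  · have : (Finset.univ.filter fun j => toggle x i j = true) =
        insert i (Finset.univ.filter fun j => x j = true) := by
      ext j
      by_cases hj : j = i
      · subst hj; simp [toggle_self, h]
      · simp [toggle_of_ne hj, hj]
    simp only [this]
    rw [Finset.card_insert_of_notMem (by simp [h])]

/-- The out-of-range values `i + 1` at `i = k` and the truncated `i - 1` at `i = 0` are harmless: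
their coefficients vanish. -/
theorem sum_jumpRate_mul (k : ℕ) (ρ : ℝ) (i : ℕ) (hi : i ≤ k) (g : ℕ → ℝ) :
    ∑ j : Fin (k + 1), jumpRate k ρ i j * g j =
      ρ * ((k : ℝ) - i) / 2 * g (i + 1) + ρ * (i : ℝ) / 2 * g (i - 1) := by
  rw [Fin.sum_univ_eq_sum_range (fun j : ℕ => jumpRate k ρ i j * g j) (k + 1)]
  have h : ∀ j, jumpRate k ρ i j * g j =
      (if j = i + 1 then ρ * ((k : ℝ) - i) / 2 * g (i + 1) else 0) +
        (if j = i - 1 then ρ * (i : ℝ) / 2 * g (i - 1) else 0) := by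
    intro j
    unfold jumpRate
    rcases Nat.eq_zero_or_pos i with h0 | h0
    · subst h0
      by_cases h1 : j = 0 + 1
      · subst h1; simp
      · simp [h1]
    · by_cases h1 : j = i + 1
      · have : j ≠ i - 1 := by omega
        simp only [if_pos h1, if_neg this]
        rw [h1]; ring
      · by_cases h2 : i = j + 1
        · have h3 : j = i - 1 := by omega
          simp only [if_neg h1, if_pos h2, if_pos h3]
          rw [← h3]; ring
        · have h3 : j ≠ i - 1 := by omega
          simp [h1, h2, h3]
  simp only [h, Finset.sum_add_distrib, Finset.sum_ite_eq', Finset.mem_range]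
  rw [if_pos (show i - 1 < k + 1 by omega)]
  congr 1
  split_ifs with h1
  · rfl
  · have : i = k := by omega
    subst this; simp

theorem sum_toggle_leftCount (k : ℕ) (ρ : ℝ) (x : Fin k → Bool) (F : Fin (k + 1) → ℝ) :
    ∑ i, ρ / 2 * (F (leftCount (toggle x i)) - F (leftCount x)) =
      ∑ j : Fin (k + 1), jumpRate k ρ (leftCount x) j * (F j - F (leftCount x)) := by
  obtain ⟨g, hFg⟩ : ∃ g : ℕ → ℝ, ∀ j : Fin (k + 1), F j = g j :=
    ⟨fun j => if h : j < k + 1 then F ⟨j, h⟩ else 0, fun j => by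
      simp only [j.2, dif_pos, Fin.eta]⟩
  have hc : (leftCount x : ℕ) ≤ k := Nat.lt_succ_iff.1 (leftCount x).2
  simp only [hFg]
  rw [sum_jumpRate_mul k ρ _ hc fun j : ℕ => g j - g (leftCount x)]
  have h1 : ∀ i, ρ / 2 * (g (leftCount (toggle x i)) - g (leftCount x)) =
      if x i = true then ρ / 2 * (g ((leftCount x : ℕ) - 1) - g (leftCount x))
      else ρ / 2 * (g ((leftCount x : ℕ) + 1) - g (leftCount x)) := by
    intro i
    rw [leftCount_toggle]
    split_ifs <;> rfl
  simp only [h1]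
  rw [Finset.sum_ite, Finset.sum_const, Finset.sum_const]
  have h2 : (Finset.univ.filter fun i => x i = true).card = (leftCount x : ℕ) := rfl
  have h3 : (Finset.univ.filter fun i => ¬ x i = true).card = k - (leftCount x : ℕ) := by
    have := Finset.card_filter_add_card_filter_not (s := Finset.univ) (fun i => x i = true)
    simp only [Finset.card_univ, Fintype.card_fin] at this
    omega
  rw [h2, h3, nsmul_eq_mul, nsmul_eq_mul, Nat.cast_sub hc]
  ring

theorem card_leftCount_eq (k : ℕ) (a : Fin (k + 1)) :
    (Finset.univ.filter fun x : Fin k → Bool => leftCount x = a).card = k.choose a := by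
  have h := Finset.card_powersetCard (a : ℕ) (Finset.univ : Finset (Fin k))
  rw [Finset.card_univ, Fintype.card_fin] at h
  rw [← h]
  refine Finset.card_bij' (fun x _ => Finset.univ.filter fun i => x i = true)
    (fun s _ i => decide (i ∈ s)) ?_ ?_ ?_ ?_
  · intro x hx
    rw [Finset.mem_filter] at hx
    rw [Finset.mem_powersetCard_univ, ← hx.2]
    rfl
  · intro s hs
    rw [Finset.mem_powersetCard_univ] at hs
    simp [leftCount, Fin.ext_iff, hs]
  · intro x _
    ext i; simp
  · intro s _
    ext i; simp

end Projection

end Ehrenfest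

namespace Ehrenfest

/-! ### The law of the chain as an image of the cube kernel. -/

section Law

variable {n m : ℕ}

theorem jumpRate_self (k : ℕ) (ρ : ℝ) (i : ℕ) : jumpRate k ρ i i = 0 := by
  simp [jumpRate]

theorem sum_generator_mul (α : ℝ) (x : State n m) (f : State n m → ℝ) :
    ∑ y, generator n m α x y * f y =
      ∑ j : Fin (n + 1), jumpRate n 1 x.1 j * (f (j, x.2) - f x) +
        ∑ j : Fin (m + 1), jumpRate m α x.2 j * (f (x.1, j) - f x) := by
  have h0 : rate n m α x x = 0 := by simp [rate, jumpRate_self]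
  have h1 : ∀ y, generator n m α x y * f y =
      rate n m α x y * f y - if x = y then (∑ z, rate n m α x z) * f x else 0 := by
    intro y
    by_cases h : x = y
    · subst h; simp [generator, h0]
    · simp [generator, h]
  have h2 : ∑ y, generator n m α x y * f y = ∑ y, rate n m α x y * (f y - f x) := by
    simp only [h1, Finset.sum_sub_distrib, mul_sub, Finset.sum_ite_eq, Finset.mem_univ, if_true,
      Finset.sum_mul]
  rw [h2]
  simp only [rate, add_mul, Finset.sum_add_distrib, ite_mul, zero_mul]
  rw [Fintype.sum_prod_type, Fintype.sum_prod_type]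
  congr 1
  · refine Finset.sum_congr rfl fun j _ => ?_
    simp
  · rw [Finset.sum_eq_single x.1]
    · simp
    · intro b _ hb
      simp [Ne.symm hb]
    · simp

/-- The numbers of regular and heavy balls in the left urn. -/
def project (x : Fin n ⊕ Fin m → Bool) : State n m :=
  (leftCount fun i => x (Sum.inl i), leftCount fun i => x (Sum.inr i))

/-- The selection rates of the balls. -/
def ballRate (n m : ℕ) (α : ℝ) : Fin n ⊕ Fin m → ℝ := Sum.elim (fun _ => 1) (fun _ => α)

theorem project_toggle_inl (x : Fin n ⊕ Fin m → Bool) (i : Fin n) :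
    project (toggle x (Sum.inl i)) =
      (leftCount (toggle (fun j => x (Sum.inl j)) i), (project x).2) := by
  unfold project
  congr 2
  funext j
  by_cases h : j = i
  · subst h; simp [toggle_self]
  · rw [toggle_of_ne h, toggle_of_ne (by simpa using h)]

theorem project_toggle_inr (x : Fin n ⊕ Fin m → Bool) (i : Fin m) :
    project (toggle x (Sum.inr i)) =
      ((project x).1, leftCount (toggle (fun j => x (Sum.inr j)) i)) := by
  unfold project
  congr 2
  funext j
  by_cases h : j = i
  · subst h; simp [toggle_self]
  · rw [toggle_of_ne h, toggle_of_ne (by simpa using h)]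

/-- Lumpability: the labelled generator applied to a function of the counts is the urn generator. -/
theorem sum_toggle_project (α : ℝ) (x : Fin n ⊕ Fin m → Bool) (f : State n m → ℝ) :
    ∑ i, ballRate n m α i / 2 * (f (project (toggle x i)) - f (project x)) =
      ∑ y, generator n m α (project x) y * f y := by
  rw [sum_generator_mul, Fintype.sum_sum_type]
  simp only [project_toggle_inl, project_toggle_inr]
  congr 1
  · exact sum_toggle_leftCount n 1 (fun j => x (Sum.inl j)) fun a => f (a, (project x).2)
  · exact sum_toggle_leftCount m α (fun j => x (Sum.inr j)) fun a => f ((project x).1, a)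

/-- The urn chain is the image of the chain of labelled balls. -/
theorem law_project (α t : ℝ) (x : Fin n ⊕ Fin m → Bool) (w : State n m) :
    law n m α t (project x) w =
      ∑ z, cubeKernel (ballRate n m α) t x z * if project z = w then 1 else 0 := by
  -- Run the labelled chain for time `t - s` and the urn chain for time `s`. Lumpability makes this
  -- constant in `s`; the ends `s = t` and `s = 0` are the two sides.
  have hd : ∀ s : ℝ, HasDerivAt (fun s : ℝ => ∑ z, cubeKernel (ballRate n m α) (t - s) x z *
      law n m α s (project z) w) 0 s := by
    intro s
    have h1 : ∀ z ∈ (Finset.univ : Finset (Fin n ⊕ Fin m → Bool)), HasDerivAt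
        (fun s : ℝ => cubeKernel (ballRate n m α) (t - s) x z * law n m α s (project z) w)
        (-(∑ i, ballRate n m α i / 2 * (cubeKernel (ballRate n m α) (t - s) x (toggle z i)
            - cubeKernel (ballRate n m α) (t - s) x z)) * law n m α s (project z) w +
          cubeKernel (ballRate n m α) (t - s) x z *
            ∑ y, generator n m α (project z) y * law n m α s y w) s := by
      intro z _
      have hk := (hasDerivAt_cubeKernel (ballRate n m α) (t - s) x z).comp s
        ((hasDerivAt_id s).const_sub t)
      have hk' := hk.mul (hasDerivAt_exp_smul_entry_left (generator n m α) s (project z) w)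
      refine hk'.congr_deriv ?_
      simp [law]
    refine (HasDerivAt.fun_sum h1).congr_deriv ?_
    rw [Finset.sum_add_distrib]
    simp only [neg_mul, Finset.sum_neg_distrib]
    rw [sum_deriv_cubeKernel _ _ _ fun z => law n m α s (project z) w]
    simp only [sum_toggle_project α _ fun y => law n m α s y w]
    simp
  have hc := is_const_of_deriv_eq_zero (fun s => (hd s).differentiableAt)
    (fun s => (hd s).deriv) t 0
  simp only [sub_self, sub_zero, cubeKernel_zero, ite_mul, one_mul, zero_mul, Finset.sum_ite_eq,
    Finset.mem_univ, if_true] at hc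
  rw [hc]
  refine Finset.sum_congr rfl fun z _ => ?_
  congr 1
  simp [law, Matrix.one_apply]

theorem card_project_eq (w : State n m) :
    (Finset.univ.filter fun x : Fin n ⊕ Fin m → Bool => project x = w).card =
      n.choose w.1 * m.choose w.2 := by
  rw [← card_leftCount_eq, ← card_leftCount_eq, ← Finset.card_product]
  refine Finset.card_equiv (Equiv.sumArrowEquivProdArrow _ _ _) fun x => ?_
  simp [project, Prod.ext_iff, Equiv.sumArrowEquivProdArrow, Function.comp_def]

theorem project_surjective : Function.Surjective (project : (Fin n ⊕ Fin m → Bool) → State n m) := by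
  intro w
  have h : 0 < (Finset.univ.filter fun x : Fin n ⊕ Fin m → Bool => project x = w).card := by
    rw [card_project_eq]
    exact Nat.mul_pos (Nat.choose_pos (Nat.lt_succ_iff.1 w.1.2))
      (Nat.choose_pos (Nat.lt_succ_iff.1 w.2.2))
  obtain ⟨x, hx⟩ := Finset.card_pos.1 h
  exact ⟨x, (Finset.mem_filter.1 hx).2⟩

theorem stationary_eq_sum (w : State n m) :
    stationary n m w = ∑ x : Fin n ⊕ Fin m → Bool,
      (1 / 2 ^ Fintype.card (Fin n ⊕ Fin m) : ℝ) * if project x = w then 1 else 0 := by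
  rw [← Finset.mul_sum, Finset.sum_boole, card_project_eq]
  simp only [stationary, Fintype.card_sum, Fintype.card_fin, pow_add]
  push_cast
  field_simp

theorem stationary_nonneg (w : State n m) : 0 ≤ stationary n m w := by
  unfold stationary; positivity

theorem law_nonneg {α : ℝ} (hα : 0 ≤ α) {t : ℝ} (ht : 0 ≤ t) (x y : State n m) :
    0 ≤ law n m α t x y := by
  obtain ⟨x, rfl⟩ := project_surjective x
  rw [law_project]
  refine Finset.sum_nonneg fun z _ => mul_nonneg (cubeKernel_nonneg ?_ ht _ _) ?_
  · rintro (i | i)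
    · exact zero_le_one
    · exact hα
  · split_ifs <;> norm_num

/-- Upper bound, uniform in the starting state, of the distance to equilibrium. -/
theorem sum_abs_law_sub_le (α t : ℝ) (x : State n m) :
    ∑ y, |law n m α t x y - stationary n m y| ≤
      √(Real.exp (n * Real.exp (-(2 * t)) + m * Real.exp (-(2 * (α * t)))) - 1) := by
  obtain ⟨x, rfl⟩ := project_surjective x
  have hs : ∑ i, Real.exp (-(ballRate n m α i * t)) ^ 2 =
      n * Real.exp (-(2 * t)) + m * Real.exp (-(2 * (α * t))) := by
    rw [Fintype.sum_sum_type]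
    simp only [ballRate, Sum.elim_inl, Sum.elim_inr, Finset.sum_const, Finset.card_univ,
      Fintype.card_fin, nsmul_eq_mul, ← Real.exp_nat_mul]
    push_cast
    ring_nf
  have h := sum_abs_cubeKernel_sub_le (ballRate n m α) t x
  rw [hs] at h
  refine le_trans ?_ h
  -- Projection does not increase the `L¹` distance, by the triangle inequality on each fibre.
  have h1 : ∀ y, |law n m α t (project x) y - stationary n m y| ≤
      ∑ z, |cubeKernel (ballRate n m α) t x z - 1 / 2 ^ Fintype.card (Fin n ⊕ Fin m)| *
        if project z = y then 1 else 0 := by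
    intro y
    rw [law_project, stationary_eq_sum, ← Finset.sum_sub_distrib]
    refine (Finset.abs_sum_le_sum_abs _ _).trans (Finset.sum_le_sum fun z _ => ?_)
    rw [← sub_mul, abs_mul]
    refine le_of_eq ?_
    congr 1
    split_ifs <;> simp
  refine (Finset.sum_le_sum fun y _ => h1 y).trans ?_
  rw [Finset.sum_comm]
  simp

theorem tendsto_law_bound (n m : ℕ) {α : ℝ} (hα : 0 < α) :
    Tendsto (fun t : ℝ =>
      √(Real.exp (n * Real.exp (-(2 * t)) + m * Real.exp (-(2 * (α * t)))) - 1)) atTop (𝓝 0) := by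
  have h1 : Tendsto (fun t : ℝ => Real.exp (-(2 * t))) atTop (𝓝 0) :=
    Real.tendsto_exp_neg_atTop_nhds_zero.comp (tendsto_id.const_mul_atTop two_pos)
  have h2 : Tendsto (fun t : ℝ => Real.exp (-(2 * (α * t)))) atTop (𝓝 0) :=
    Real.tendsto_exp_neg_atTop_nhds_zero.comp
      ((tendsto_id.const_mul_atTop hα).const_mul_atTop two_pos)
  have h3 := ((Real.continuous_exp.tendsto _).comp
    ((h1.const_mul (n : ℝ)).add (h2.const_mul (m : ℝ)))).sub_const 1
  have h4 := (Real.continuous_sqrt.tendsto _).comp h3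
  simpa [Function.comp_def] using h4

theorem tendsto_sum_law_mul {α : ℝ} (hα : 0 < α) (x : State n m) (f : State n m → ℝ) :
    Tendsto (fun t => ∑ y, law n m α t x y * f y) atTop (𝓝 (∑ y, stationary n m y * f y)) := by
  refine tendsto_finsetSum _ fun y _ => Tendsto.mul_const _ ?_
  rw [tendsto_iff_norm_sub_tendsto_zero]
  refine squeeze_zero (fun t => norm_nonneg _) (fun t => ?_) (tendsto_law_bound n m hα)
  refine le_trans ?_ (sum_abs_law_sub_le α t x)
  exact Finset.single_le_sum (f := fun y => |law n m α t x y - stationary n m y|)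
    (fun z _ => abs_nonneg _) (Finset.mem_univ y)

theorem sum_law_mul_eigenfunction {α : ℝ} {f : State n m → ℝ} {c : ℝ}
    (hf : ∀ x, ∑ y, generator n m α x y * f y = c * f x) (t : ℝ) (x : State n m) :
    ∑ y, law n m α t x y * f y = Real.exp (c * t) * f x :=
  exp_smul_apply_eigenfunction _ f c hf t x

/-- The mean of `f` at time `t` tends to the stationary mean, but equals `exp (c t) * f 0`, which
tends to 0. -/
theorem sum_stationary_mul_eigenfunction {α : ℝ} (hα : 0 < α) {f : State n m → ℝ} {c : ℝ}
    (hc : c < 0) (hf : ∀ x, ∑ y, generator n m α x y * f y = c * f x) :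
    ∑ y, stationary n m y * f y = 0 := by
  have h := tendsto_sum_law_mul hα (0 : State n m) f
  simp only [sum_law_mul_eigenfunction hf] at h
  have h2 : Tendsto (fun t : ℝ => Real.exp (c * t) * f 0) atTop (𝓝 (0 * f 0)) :=
    (Real.tendsto_exp_atBot.comp (tendsto_id.const_mul_atTop_of_neg hc)).mul_const _
  rw [zero_mul] at h2
  exact tendsto_nhds_unique h h2

theorem sum_law (α t : ℝ) (x : State n m) : ∑ y, law n m α t x y = 1 := by
  have h := sum_law_mul_eigenfunction (α := α) (f := fun _ : State n m => 1) (c := 0)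
    (fun x => by rw [sum_generator_mul]; simp) t x
  simpa using h

theorem sum_stationary : ∑ y, stationary n m y = 1 := by
  have h := tendsto_sum_law_mul one_pos (0 : State n m) fun _ => 1
  simp only [mul_one, sum_law] at h
  exact tendsto_nhds_unique h tendsto_const_nhds

end Law

/-! ### Linear and quadratic eigenfunctions. -/

section Eigen

variable {n m : ℕ}

theorem sum_jumpRate_linear (k : ℕ) (ρ : ℝ) (i : Fin (k + 1)) :
    ∑ j : Fin (k + 1), jumpRate k ρ i j * ((2 * (j : ℝ) - k) - (2 * (i : ℝ) - k)) =
      -ρ * (2 * (i : ℝ) - k) := by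
  rw [sum_jumpRate_mul k ρ i (Nat.lt_succ_iff.1 i.2)
    fun j : ℕ => (2 * (j : ℝ) - k) - (2 * (i : ℝ) - k)]
  rcases Nat.eq_zero_or_pos (i : ℕ) with h | h
  · rw [h]; push_cast; ring
  · rw [Nat.cast_sub h]; push_cast; ring

/-- In terms of spins this function is `2 ∑_{i<j} s_i s_j`; each pair product decays at rate `2ρ`.
-/
theorem sum_jumpRate_quadratic (k : ℕ) (ρ : ℝ) (i : Fin (k + 1)) :
    ∑ j : Fin (k + 1), jumpRate k ρ i j * (((2 * (j : ℝ) - k) ^ 2 - k) - ((2 * (i : ℝ) - k) ^ 2 - k))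
      = -(2 * ρ) * ((2 * (i : ℝ) - k) ^ 2 - k) := by
  rw [sum_jumpRate_mul k ρ i (Nat.lt_succ_iff.1 i.2)
    fun j : ℕ => ((2 * (j : ℝ) - k) ^ 2 - k) - ((2 * (i : ℝ) - k) ^ 2 - k)]
  rcases Nat.eq_zero_or_pos (i : ℕ) with h | h
  · rw [h]; push_cast; ring
  · rw [Nat.cast_sub h]; push_cast; ring

theorem generator_regular_linear (α : ℝ) (x : State n m) :
    ∑ y, generator n m α x y * (2 * (y.1 : ℝ) - n) = -1 * (2 * (x.1 : ℝ) - n) := by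
  rw [sum_generator_mul, sum_jumpRate_linear n 1 x.1]; simp

theorem generator_heavy_linear (α : ℝ) (x : State n m) :
    ∑ y, generator n m α x y * (2 * (y.2 : ℝ) - m) = -α * (2 * (x.2 : ℝ) - m) := by
  rw [sum_generator_mul, sum_jumpRate_linear m α x.2]; simp

theorem generator_regular_quadratic (α : ℝ) (x : State n m) :
    ∑ y, generator n m α x y * ((2 * (y.1 : ℝ) - n) ^ 2 - n) =
      -(2 * 1) * ((2 * (x.1 : ℝ) - n) ^ 2 - n) := by
  rw [sum_generator_mul, sum_jumpRate_quadratic n 1 x.1]; simp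

theorem generator_heavy_quadratic (α : ℝ) (x : State n m) :
    ∑ y, generator n m α x y * ((2 * (y.2 : ℝ) - m) ^ 2 - m) =
      -(2 * α) * ((2 * (x.2 : ℝ) - m) ^ 2 - m) := by
  rw [sum_generator_mul, sum_jumpRate_quadratic m α x.2]; simp

end Eigen

end Ehrenfest

namespace Ehrenfest

/-! ### Bounds on the distance to equilibrium. -/

section Bounds

/-- Second moment lower bound for the total variation distance. -/
theorem one_sub_le_tvDist {ι : Type*} [Fintype ι] {p q φ : ι → ℝ} {μ v : ℝ} (hμ : 0 < μ)
    (hp : ∀ y, 0 ≤ p y) (hq : ∀ y, 0 ≤ q y) (hp1 : ∑ y, p y = 1) (hq1 : ∑ y, q y = 1)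
    (hpv : ∑ y, p y * (φ y - μ) ^ 2 ≤ v) (hqv : ∑ y, q y * φ y ^ 2 ≤ v) :
    1 - 8 * v / μ ^ 2 ≤ tvDist p q := by
  have hμ2 : 0 < μ ^ 2 := by positivity
  -- Chebyshev at the threshold `μ / 2`: on each side one penalty is at least `8 * (1/2)^2 = 2`,
  -- turning its coefficient from `1` to at most `-1`.
  have h : ∀ y, p y * (1 - 8 * (φ y - μ) ^ 2 / μ ^ 2) + q y * (1 - 8 * φ y ^ 2 / μ ^ 2) ≤
      |p y - q y| := by
    intro y
    have hA : 0 ≤ 8 * (φ y - μ) ^ 2 / μ ^ 2 := by positivity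
    have hB : 0 ≤ 8 * φ y ^ 2 / μ ^ 2 := by positivity
    rcases le_total (φ y) (μ / 2) with hφ | hφ
    · have h2 : 2 ≤ 8 * (φ y - μ) ^ 2 / μ ^ 2 := by
        rw [le_div_iff₀ hμ2]; nlinarith
      have := neg_abs_le (p y - q y)
      nlinarith [mul_nonneg (hp y) (sub_nonneg.2 h2), mul_nonneg (hq y) hB]
    · have h2 : 2 ≤ 8 * φ y ^ 2 / μ ^ 2 := by
        rw [le_div_iff₀ hμ2]; nlinarith
      have := le_abs_self (p y - q y)
      nlinarith [mul_nonneg (hq y) (sub_nonneg.2 h2), mul_nonneg (hp y) hA]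
  have hs := Finset.sum_le_sum fun y (_ : y ∈ Finset.univ) => h y
  have he : ∑ y, (p y * (1 - 8 * (φ y - μ) ^ 2 / μ ^ 2) + q y * (1 - 8 * φ y ^ 2 / μ ^ 2)) =
      2 - 8 / μ ^ 2 * (∑ y, p y * (φ y - μ) ^ 2) - 8 / μ ^ 2 * ∑ y, q y * φ y ^ 2 := by
    have : (2 : ℝ) = ∑ y, p y + ∑ y, q y := by rw [hp1, hq1]; norm_num
    rw [this, Finset.mul_sum, Finset.mul_sum, ← Finset.sum_add_distrib, ← Finset.sum_sub_distrib,
      ← Finset.sum_sub_distrib]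
    exact Finset.sum_congr rfl fun y _ => by ring
  rw [he] at hs
  have h8 : 0 ≤ 8 / μ ^ 2 := by positivity
  have h1 := mul_le_mul_of_nonneg_left hpv h8
  have h2 := mul_le_mul_of_nonneg_left hqv h8
  unfold tvDist
  have : 8 * v / μ ^ 2 = 8 / μ ^ 2 * v := by ring
  rw [this]
  linarith

variable {n m : ℕ} {α : ℝ}

theorem tvDist_le_distToEq (t : ℝ) (x : State n m) :
    tvDist (law n m α t x) (stationary n m) ≤ distToEq n m α t :=
  Finset.le_sup' (fun x : State n m => tvDist (law n m α t x) (stationary n m))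
    (Finset.mem_univ x)

theorem distToEq_le (t : ℝ) :
    distToEq n m α t ≤
      √(Real.exp (n * Real.exp (-(2 * t)) + m * Real.exp (-(2 * (α * t)))) - 1) := by
  refine Finset.sup'_le _ _ fun x _ => ?_
  have h := sum_abs_law_sub_le α t x
  have h0 : 0 ≤ ∑ y, |law n m α t x y - stationary n m y| :=
    Finset.sum_nonneg fun _ _ => abs_nonneg _
  unfold tvDist
  linarith

/-- Lower bound of the distance to equilibrium by an eigenfunction `f` of rate `c` such that
`f ^ 2 - k` has rate `2 * c`. -/
theorem one_sub_le_distToEq (hα : 0 < α) {f : State n m → ℝ} {c k : ℝ} (hc : 0 < c) (hk : 0 < k)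
    (hf : ∀ x, ∑ y, generator n m α x y * f y = -c * f x)
    (hf2 : ∀ x, ∑ y, generator n m α x y * (f y ^ 2 - k) = -(2 * c) * (f x ^ 2 - k))
    {x : State n m} (hx : f x = k) {t : ℝ} (ht : 0 ≤ t) :
    1 - 8 * Real.exp (2 * (c * t)) / k ≤ distToEq n m α t := by
  have h1 := sum_law_mul_eigenfunction hf t x
  have h2 := sum_law_mul_eigenfunction (f := fun y => f y ^ 2 - k) hf2 t x
  have h3 := sum_stationary_mul_eigenfunction (f := fun y => f y ^ 2 - k) hα
    (by linarith : -(2 * c) < 0) hf2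
  simp only [mul_sub, Finset.sum_sub_distrib, ← Finset.sum_mul, sum_law, sum_stationary,
    one_mul] at h2 h3
  have he : Real.exp (-(2 * c) * t) = Real.exp (-c * t) ^ 2 := by
    rw [← Real.exp_nat_mul]; congr 1; push_cast; ring
  have hi : Real.exp (2 * (c * t)) * Real.exp (-c * t) ^ 2 = 1 := by
    rw [← he, ← Real.exp_add]; simp; ring
  rw [he] at h2
  set θ := Real.exp (-c * t) with hθ
  have hθ0 : 0 < θ := Real.exp_pos _
  refine le_trans ?_ (tvDist_le_distToEq t x)
  -- From `f x = k` the mean is `θ k` and the variance `k (1 - θ²) ≤ k`; at equilibrium the second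
  -- moment is `k`.
  refine le_trans (le_of_eq ?_) (one_sub_le_tvDist (φ := f) (μ := θ * k) (v := k) (by positivity)
    (law_nonneg hα.le ht x) stationary_nonneg (sum_law α t x) sum_stationary ?_ ?_)
  · have hE : Real.exp (2 * (c * t)) = 1 / θ ^ 2 := by
      rw [eq_div_iff (by positivity)]; exact hi
    rw [hE]
    field_simp
  · have : ∑ y, law n m α t x y * (f y - θ * k) ^ 2 =
        ∑ y, law n m α t x y * f y ^ 2 - 2 * (θ * k) * ∑ y, law n m α t x y * f y
          + (θ * k) ^ 2 * ∑ y, law n m α t x y := by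
      rw [Finset.mul_sum, Finset.mul_sum, ← Finset.sum_sub_distrib, ← Finset.sum_add_distrib]
      exact Finset.sum_congr rfl fun y _ => by ring
    rw [this, h1, sum_law, hx]
    rw [hx] at h2
    nlinarith [mul_nonneg hk.le (sq_nonneg θ)]
  · linarith

theorem one_sub_regular_le_distToEq (hα : 0 < α) (hn : 1 ≤ n) {t : ℝ} (ht : 0 ≤ t) :
    1 - 8 * Real.exp (2 * t) / n ≤ distToEq n m α t := by
  have h := one_sub_le_distToEq (f := fun y : State n m => 2 * (y.1 : ℝ) - n) (k := n)
    (x := (Fin.last n, 0)) hα one_pos (by exact_mod_cast hn) (generator_regular_linear α)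
    (generator_regular_quadratic α) (by simp; ring) ht
  simpa using h

theorem one_sub_heavy_le_distToEq (hα : 0 < α) (hm : 1 ≤ m) {t : ℝ} (ht : 0 ≤ t) :
    1 - 8 * Real.exp (2 * (α * t)) / m ≤ distToEq n m α t :=
  one_sub_le_distToEq (f := fun y : State n m => 2 * (y.2 : ℝ) - m) (k := m)
    (x := (0, Fin.last m)) hα hα (by exact_mod_cast hm) (generator_heavy_linear α)
    (generator_heavy_quadratic α) (by simp; ring) ht

theorem abs_sum_law_sub_mul_le (t : ℝ) (x : State n m) {f : State n m → ℝ} {C : ℝ}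
    (hf : ∀ y, |f y| ≤ C) :
    |∑ y, law n m α t x y * f y - ∑ y, stationary n m y * f y| ≤
      C * ∑ y, |law n m α t x y - stationary n m y| := by
  rw [← Finset.sum_sub_distrib, Finset.mul_sum]
  refine (Finset.abs_sum_le_sum_abs _ _).trans (Finset.sum_le_sum fun y _ => ?_)
  rw [← sub_mul, abs_mul, mul_comm]
  exact mul_le_mul_of_nonneg_right (hf y) (abs_nonneg _)

/-- Test against the heavy linear eigenfunction, bounded by `m` and equal to `m` at the start. This
stays informative at all times, even for bounded `m`. -/
theorem exp_neg_le_distToEq (hα : 0 < α) (hm : 1 ≤ m) (t : ℝ) :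
    Real.exp (-(α * t)) / 2 ≤ distToEq n m α t := by
  have hm' : (0 : ℝ) < m := by exact_mod_cast hm
  refine le_trans ?_ (tvDist_le_distToEq t (0, Fin.last m))
  have h := abs_sum_law_sub_mul_le (α := α) t ((0, Fin.last m) : State n m)
    (f := fun y => 2 * (y.2 : ℝ) - m) (C := m) (by
      intro y
      have : (y.2 : ℝ) ≤ m := by exact_mod_cast Nat.lt_succ_iff.1 y.2.2
      have h0 : (0 : ℝ) ≤ (y.2 : ℕ) := Nat.cast_nonneg _
      exact abs_le.2 ⟨by linarith, by linarith⟩)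
  rw [sum_law_mul_eigenfunction (generator_heavy_linear α),
    sum_stationary_mul_eigenfunction hα (neg_lt_zero.2 hα) (generator_heavy_linear α), sub_zero] at h
  have h2 := (le_abs_self _).trans h
  simp only [Fin.val_last] at h2
  have h3 : Real.exp (-α * t) * (2 * (m : ℝ) - m) = m * Real.exp (-(α * t)) := by
    rw [neg_mul]; ring
  rw [h3] at h2
  have := le_of_mul_le_mul_left h2 hm'
  unfold tvDist
  linarith

end Bounds

/-! ### The spectral gap. -/

section Gap

variable {n m : ℕ} {α : ℝ}

/-- The mean of `f` decays exactly like `exp (-c t)`, while the upper bound forces decay at speed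
`exp (-α t)`; `c < α` would give `f = 0`. -/
theorem le_of_eigenfunction (hα0 : 0 < α) (hα1 : α ≤ 1) {c : ℝ} (hc : 0 < c)
    {f : State n m → ℝ} (hf0 : f ≠ 0)
    (hf : ∀ x, ∑ y, generator n m α x y * f y = -c * f x) : α ≤ c := by
  by_contra! hlt
  obtain ⟨x, hx⟩ : ∃ x, f x ≠ 0 := by
    by_contra! h
    exact hf0 (funext h)
  have hC : ∀ y, |f y| ≤ ∑ z, |f z| := fun y =>
    Finset.single_le_sum (f := fun z => |f z|) (fun _ _ => abs_nonneg _) (Finset.mem_univ y)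
  set C := ∑ z, |f z| with hCdef
  have hC0 : 0 ≤ C := Finset.sum_nonneg fun _ _ => abs_nonneg _
  -- Comes from `exp w - 1 ≤ w * exp w` with `w ≤ (n + m) exp (-2 α t) ≤ n + m`.
  set K : ℝ := (n + m) * Real.exp (n + m) with hK
  have hbound : ∀ t : ℝ, 0 ≤ t → |f x| ≤ C * √K * Real.exp (-((α - c) * t)) := by
    intro t ht
    have h := (abs_sum_law_sub_mul_le (α := α) t x hC).trans
      (mul_le_mul_of_nonneg_left (sum_abs_law_sub_le α t x) hC0)
    rw [sum_law_mul_eigenfunction hf,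
      sum_stationary_mul_eigenfunction hα0 (neg_lt_zero.2 hc) hf, sub_zero, abs_mul,
      Real.abs_exp] at h
    set w : ℝ := n * Real.exp (-(2 * t)) + m * Real.exp (-(2 * (α * t))) with hw
    have hE : Real.exp (-(2 * t)) ≤ Real.exp (-(2 * (α * t))) :=
      Real.exp_le_exp.2 (by nlinarith)
    have hE1 : Real.exp (-(2 * (α * t))) ≤ 1 :=
      Real.exp_le_one_iff.2 (by nlinarith [mul_nonneg hα0.le ht])
    have hE0 := Real.exp_pos (-(2 * (α * t)))
    have hn : (0 : ℝ) ≤ n := Nat.cast_nonneg _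
    have hm : (0 : ℝ) ≤ m := Nat.cast_nonneg _
    have hw1 : w ≤ (n + m) * Real.exp (-(2 * (α * t))) := by
      rw [hw, add_mul]
      gcongr
    have hw2 : w ≤ n + m := hw1.trans (mul_le_of_le_one_right (by positivity) hE1)
    have hw0 : 0 ≤ w := by positivity
    have hexp : Real.exp w - 1 ≤ K * Real.exp (-(α * t)) ^ 2 := by
      have h1 : Real.exp w - 1 ≤ w * Real.exp w := by
        have h2 := Real.add_one_le_exp (-w)
        have h3 : Real.exp (-w) * Real.exp w = 1 := by rw [← Real.exp_add]; simp
        nlinarith [Real.exp_pos w]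
      have h4 : Real.exp (-(α * t)) ^ 2 = Real.exp (-(2 * (α * t))) := by
        rw [← Real.exp_nat_mul]; congr 1; push_cast; ring
      rw [h4, hK]
      calc _ ≤ w * Real.exp w := h1
        _ ≤ ((n + m) * Real.exp (-(2 * (α * t)))) * Real.exp (n + m) := by gcongr
        _ = _ := by ring
    have hs : √(Real.exp w - 1) ≤ √K * Real.exp (-(α * t)) := by
      refine (Real.sqrt_le_sqrt hexp).trans ?_
      rw [Real.sqrt_mul (by positivity), Real.sqrt_sq (Real.exp_pos _).le]
    have h5 := h.trans (mul_le_mul_of_nonneg_left hs hC0)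
    have h6 : Real.exp (c * t) * Real.exp (-c * t) = 1 := by
      rw [← Real.exp_add]; simp
    have h7 : Real.exp (-((α - c) * t)) = Real.exp (c * t) * Real.exp (-(α * t)) := by
      rw [← Real.exp_add]; congr 1; ring
    have h8 := mul_le_mul_of_nonneg_left h5 (Real.exp_pos (c * t)).le
    rw [← mul_assoc, h6, one_mul] at h8
    rw [h7]
    linarith
  have hlim : Tendsto (fun t : ℝ => C * √K * Real.exp (-((α - c) * t))) atTop
      (𝓝 (C * √K * 0)) :=
    (Real.tendsto_exp_neg_atTop_nhds_zero.comp
      (tendsto_id.const_mul_atTop (sub_pos.2 hlt))).const_mul _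
  have h := ge_of_tendsto hlim ((eventually_ge_atTop 0).mono hbound)
  rw [mul_zero] at h
  exact hx (abs_nonpos_iff.1 h)

theorem spectralGap_generator (hα0 : 0 < α) (hα1 : α ≤ 1) (hm : 1 ≤ m) :
    spectralGap (generator n m α) = α := by
  refine IsLeast.csInf_eq ⟨⟨hα0, ?_⟩, ?_⟩
  · refine Module.End.hasEigenvalue_of_hasEigenvector
      (x := fun y : State n m => 2 * (y.2 : ℝ) - m) ⟨?_, ?_⟩
    · rw [Module.End.mem_eigenspace_iff]
      funext x
      have h := generator_heavy_linear (n := n) α x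
      simp only [Matrix.toLin'_apply, Matrix.neg_mulVec, Pi.neg_apply, Pi.smul_apply, smul_eq_mul]
      rw [show (generator n m α).mulVec (fun y : State n m => 2 * (y.2 : ℝ) - m) x
        = ∑ y, generator n m α x y * (2 * (y.2 : ℝ) - m) from rfl, h]
      ring
    · intro h
      have h2 := congrFun h ((0, 0) : State n m)
      have hm' : (0 : ℝ) < m := by exact_mod_cast hm
      simp at h2
      omega
  · rintro c ⟨hc, he⟩
    obtain ⟨f, hf, hf0⟩ := he.exists_hasEigenvector
    rw [Module.End.mem_eigenspace_iff] at hf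
    refine le_of_eigenfunction hα0 hα1 hc hf0 fun x => ?_
    have h := congrFun hf x
    simp only [Matrix.toLin'_apply, Matrix.neg_mulVec, Pi.neg_apply, Pi.smul_apply,
      smul_eq_mul] at h
    have h2 : (generator n m α).mulVec f x = ∑ y, generator n m α x y * f y := rfl
    rw [← h2]
    linarith

theorem relaxationTime_generator (hα0 : 0 < α) (hα1 : α ≤ 1) (hm : 1 ≤ m) :
    relaxationTime (generator n m α) = α⁻¹ := by
  rw [relaxationTime, spectralGap_generator hα0 hα1 hm]

end Gap

/-! ### Mixing times up to `O(1/α)`. -/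

section Mixing

theorem mixingTime_le {D : ℝ → ℝ} {ε t : ℝ} (ht : 0 ≤ t) (h : D t ≤ ε) : mixingTime D ε ≤ t :=
  csInf_le ⟨0, fun _ hs => hs.1⟩ ⟨ht, h⟩

theorem mixingTime_nonneg (D : ℝ → ℝ) (ε : ℝ) : 0 ≤ mixingTime D ε :=
  Real.sInf_nonneg fun _ hs => hs.1

/-- Nonemptiness matters because `sInf ∅ = 0` in `ℝ`. -/
theorem le_mixingTime {D : ℝ → ℝ} {ε a : ℝ} (hne : ∃ t, 0 ≤ t ∧ D t ≤ ε)
    (h : ∀ s, 0 ≤ s → D s ≤ ε → a ≤ s) : a ≤ mixingTime D ε :=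
  le_csInf hne fun s hs => h s hs.1 hs.2

variable {n m : ℕ} {α : ℝ}

theorem exists_distToEq_le (n m : ℕ) (hα : 0 < α) {ε : ℝ} (hε : 0 < ε) :
    ∃ t, 0 ≤ t ∧ distToEq n m α t ≤ ε := by
  have h := ((tendsto_law_bound n m hα).eventually (gt_mem_nhds hε)).and (eventually_ge_atTop 0)
  obtain ⟨t, h1, h2⟩ := h.exists
  exact ⟨t, h2, (distToEq_le t).trans h1.le⟩

theorem mixingTime_anti (n m : ℕ) (hα : 0 < α) {ε δ : ℝ} (hε : 0 < ε) (h : ε ≤ δ) :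
    mixingTime (distToEq n m α) δ ≤ mixingTime (distToEq n m α) ε :=
  le_mixingTime (exists_distToEq_le n m hα hε) fun _ hs hD => mixingTime_le hs (hD.trans h)

theorem log_inv_le_mul_mixingTime (hα : 0 < α) (hm : 1 ≤ m) {ε : ℝ} (hε : 0 < ε) :
    Real.log (1 / (2 * ε)) ≤ α * mixingTime (distToEq n m α) ε := by
  rw [← div_le_iff₀' hα]
  refine le_mixingTime (exists_distToEq_le n m hα hε) fun s _ hD => ?_
  rw [div_le_iff₀ hα, Real.log_le_iff_le_exp (by positivity)]
  have h := (exp_neg_le_distToEq (n := n) hα hm s).trans hD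
  rw [div_le_iff₀ (by positivity)]
  have h1 : Real.exp (-(α * s)) * Real.exp (s * α) = 1 := by
    rw [← Real.exp_add, mul_comm s]; simp
  nlinarith [Real.exp_pos (s * α)]

/-- The scale `max (log n / 2) (log m / (2 α))` at which the chain mixes. -/
noncomputable def cutoffTime (n m : ℕ) (α : ℝ) : ℝ := max (Real.log n / 2) (Real.log m / (2 * α))

theorem cutoffTime_nonneg : 0 ≤ cutoffTime n m α :=
  le_max_of_le_left (div_nonneg (Real.log_natCast_nonneg n) two_pos.le)

/-- After the shift `s / α ≥ s` both terms of the exponent are at most `exp (-2 s)`. The bound is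
kept in the shape of the case `n = m = α = 1`, so that `tendsto_law_bound 1 1` supplies `s`
independently of the chain. -/
theorem distToEq_cutoffTime_add_le (hn : 1 ≤ n) (hm : 1 ≤ m) (hα0 : 0 < α) (hα1 : α ≤ 1) {s : ℝ}
    (hs : 0 ≤ s) : distToEq n m α (cutoffTime n m α + s / α) ≤
      √(Real.exp ((1 : ℕ) * Real.exp (-(2 * s)) + (1 : ℕ) * Real.exp (-(2 * (1 * s)))) - 1) := by
  refine (distToEq_le _).trans (Real.sqrt_le_sqrt ?_)
  have hn' : (0 : ℝ) < n := by exact_mod_cast hn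
  have hm' : (0 : ℝ) < m := by exact_mod_cast hm
  have key : ∀ {k b : ℝ}, 0 < k → Real.log k + 2 * s ≤ b →
      k * Real.exp (-b) ≤ Real.exp (-(2 * s)) := by
    intro k b hk hb
    nth_rw 1 [← Real.exp_log hk]
    rw [← Real.exp_add]
    exact Real.exp_le_exp.2 (by linarith)
  have h1 : Real.log n / 2 ≤ cutoffTime n m α := le_max_left _ _
  have h2 : Real.log m / (2 * α) ≤ cutoffTime n m α := le_max_right _ _
  have h3 : s ≤ s / α := by rw [le_div_iff₀ hα0]; nlinarith
  have h4 : α * (s / α) = s := by field_simp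
  rw [div_le_iff₀ (by positivity)] at h2
  have k1 := key (b := 2 * (cutoffTime n m α + s / α)) hn' (by linarith)
  have k2 := key (b := 2 * (α * (cutoffTime n m α + s / α))) hm' (by rw [mul_add, h4]; linarith)
  have h5 : Real.exp ((n : ℝ) * Real.exp (-(2 * (cutoffTime n m α + s / α))) +
      m * Real.exp (-(2 * (α * (cutoffTime n m α + s / α))))) ≤
      Real.exp ((1 : ℕ) * Real.exp (-(2 * s)) + (1 : ℕ) * Real.exp (-(2 * (1 * s)))) := by
    refine Real.exp_le_exp.2 ?_
    push_cast
    simp only [one_mul]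
    linarith
  linarith

/-- The mixing times of all levels agree with `cutoffTime` up to `O(α⁻¹)`. -/
theorem exists_abs_mixingTime_sub_le {ε : ℝ} (hε0 : 0 < ε) (hε1 : ε < 1) :
    ∃ C : ℝ, ∀ (n m : ℕ) (α : ℝ), 1 ≤ n → 1 ≤ m → 0 < α → α ≤ 1 →
      |α * mixingTime (distToEq n m α) ε - α * cutoffTime n m α| ≤ C := by
  have hev := ((tendsto_law_bound 1 1 one_pos).eventually (gt_mem_nhds hε0)).and
    (eventually_ge_atTop 0)
  obtain ⟨s, hs1, hs0⟩ := hev.exists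
  have hc0 : 0 ≤ Real.log (8 / (1 - ε)) :=
    Real.log_nonneg (by rw [le_div_iff₀ (by linarith)]; linarith)
  refine ⟨s + Real.log (8 / (1 - ε)) / 2, fun n m α hn hm hα0 hα1 => ?_⟩
  have hn' : (0 : ℝ) < n := by exact_mod_cast hn
  have hm' : (0 : ℝ) < m := by exact_mod_cast hm
  have hU : mixingTime (distToEq n m α) ε ≤ cutoffTime n m α + s / α :=
    mixingTime_le (add_nonneg cutoffTime_nonneg (div_nonneg hs0 hα0.le))
      ((distToEq_cutoffTime_add_le hn hm hα0 hα1 hs0).trans hs1.le)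
  -- Solves the second moment bound for time; this is the origin of `8 / (1 - ε)`.
  have key : ∀ {k b : ℝ}, 0 < k → 1 - 8 * Real.exp b / k ≤ ε →
      Real.log k - Real.log (8 / (1 - ε)) ≤ b := by
    intro k b hk h
    rw [← Real.log_div hk.ne' (by have : 0 < 1 - ε := by linarith
                                  positivity)]
    have h8 : 0 < 1 - ε := by linarith
    rw [Real.log_le_iff_le_exp (by positivity), div_div_eq_mul_div, div_le_iff₀ (by norm_num)]
    have h9 : 1 - ε ≤ 8 * Real.exp b / k := by linarith
    rw [le_div_iff₀ hk] at h9
    linarith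
  have hL : cutoffTime n m α - Real.log (8 / (1 - ε)) / 2 / α ≤
      mixingTime (distToEq n m α) ε := by
    refine le_mixingTime (exists_distToEq_le n m hα0 hε0) fun t ht hD => ?_
    have h1 := key hn' ((one_sub_regular_le_distToEq hα0 hn ht).trans hD)
    have h2 := key hm' ((one_sub_heavy_le_distToEq hα0 hm ht).trans hD)
    rw [sub_le_iff_le_add]
    refine max_le ?_ ?_
    · have h3 : Real.log (8 / (1 - ε)) / 2 ≤ Real.log (8 / (1 - ε)) / 2 / α := by
        rw [le_div_iff₀ hα0]; nlinarith
      linarith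
    · rw [div_le_iff₀ (by positivity)]
      have : (t + Real.log (8 / (1 - ε)) / 2 / α) * (2 * α) =
          2 * (α * t) + Real.log (8 / (1 - ε)) := by field_simp
      linarith
  have h1 := mul_le_mul_of_nonneg_left hU hα0.le
  have h2 := mul_le_mul_of_nonneg_left hL hα0.le
  have h3 : α * (s / α) = s := by field_simp
  have h4 : α * (Real.log (8 / (1 - ε)) / 2 / α) = Real.log (8 / (1 - ε)) / 2 := by field_simp
  rw [mul_add, h3] at h1
  rw [mul_sub, h4] at h2
  exact abs_le.2 ⟨by linarith, by linarith⟩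

end Mixing

/-! ### Cutoff versus the product condition. -/

section Cutoff

theorem tendsto_div_one_of_abs_sub_le {u a : ℕ → ℝ} {C : ℝ}
    (h : ∀ᶠ N in atTop, |u N - a N| ≤ C) (ha : Tendsto a atTop atTop) :
    Tendsto (fun N => u N / a N) atTop (𝓝 1) := by
  rw [tendsto_iff_norm_sub_tendsto_zero]
  have h0 : Tendsto (fun N => C / a N) atTop (𝓝 0) := ha.const_div_atTop C
  refine squeeze_zero' (Eventually.of_forall fun N => norm_nonneg _) ?_ h0
  filter_upwards [h, ha.eventually_gt_atTop 0] with N hN hpos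
  rw [Real.norm_eq_abs, div_sub_one hpos.ne', abs_div, abs_of_pos hpos]
  gcongr

variable {α : ℕ → ℝ} {n m : ℕ → ℕ}

theorem hasCutoff_of_tendsto_mul_mixingTime
    (hα : ∀ᶠ N in atTop, 0 < α N ∧ α N ≤ 1) (hn : ∀ᶠ N in atTop, 1 ≤ n N)
    (hm : ∀ᶠ N in atTop, 1 ≤ m N) {δ : ℝ} (hδ0 : 0 < δ) (hδ1 : δ < 1)
    (h : Tendsto (fun N => α N * mixingTime (distToEq (n N) (m N) (α N)) δ) atTop atTop) :
    HasCutoff fun N => distToEq (n N) (m N) (α N) := by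
  -- Each level is compared with the fixed level `δ`; dividing two such limits cancels it.
  have key : ∀ ε : ℝ, 0 < ε → ε < 1 → Tendsto (fun N =>
      (α N * mixingTime (distToEq (n N) (m N) (α N)) ε) /
        (α N * mixingTime (distToEq (n N) (m N) (α N)) δ)) atTop (𝓝 1) := by
    intro ε h0 h1
    obtain ⟨C, hC⟩ := exists_abs_mixingTime_sub_le h0 h1
    obtain ⟨C', hC'⟩ := exists_abs_mixingTime_sub_le hδ0 hδ1
    refine tendsto_div_one_of_abs_sub_le (C := C + C') ?_ h
    filter_upwards [hα, hn, hm] with N h1 h2 h3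
    have e1 := hC _ _ _ h2 h3 h1.1 h1.2
    have e2 := hC' _ _ _ h2 h3 h1.1 h1.2
    rw [abs_le] at e1 e2 ⊢
    exact ⟨by linarith [e1.1, e2.2], by linarith [e1.2, e2.1]⟩
  intro ε h0 h1
  have h2 := (key ε h0 h1).div (key (1 - ε) (by linarith) (by linarith)) one_ne_zero
  rw [div_one] at h2
  refine h2.congr' ?_
  filter_upwards [hα, h.eventually_gt_atTop 0] with N hN hpos
  simp only [Pi.div_apply]
  rw [div_div_div_cancel_right₀ hpos.ne', mul_div_mul_left _ _ hN.1.ne']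

theorem tendsto_mul_mixingTime_of_hasCutoff
    (hα : ∀ᶠ N in atTop, 0 < α N) (hm : ∀ᶠ N in atTop, 1 ≤ m N) {δ : ℝ} (hδ0 : 0 < δ)
    (hδ1 : δ < 1) (h : HasCutoff fun N => distToEq (n N) (m N) (α N)) :
    Tendsto (fun N => α N * mixingTime (distToEq (n N) (m N) (α N)) δ) atTop atTop := by
  rw [tendsto_atTop]
  intro B
  -- The first entry gives `α * t_mix(ε) ≥ 2 B`, where the 2 pays for the ratio being eventually
  -- below 2; `ε ≤ 1 - δ` gives `t_mix(1 - ε) ≤ t_mix(δ)`.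
  set ε : ℝ := min (Real.exp (-(2 * B)) / 2) (min δ (1 - δ)) with hε
  have hε0 : 0 < ε := lt_min (by positivity) (lt_min hδ0 (by linarith))
  have hεB : ε ≤ Real.exp (-(2 * B)) / 2 := min_le_left _ _
  have hεδ : ε ≤ 1 - δ := (min_le_right _ _).trans (min_le_right _ _)
  have hε1 : ε < 1 := by linarith
  have hlog : 2 * B ≤ Real.log (1 / (2 * ε)) := by
    rw [Real.le_log_iff_exp_le (by positivity), le_div_iff₀ (by positivity)]
    have h1 : Real.exp (2 * B) * Real.exp (-(2 * B)) = 1 := by rw [← Real.exp_add]; simp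
    nlinarith [Real.exp_pos (2 * B)]
  have hr := h ε hε0 hε1
  filter_upwards [hα, hm, hr.eventually (gt_mem_nhds one_lt_two),
    hr.eventually (lt_mem_nhds one_pos)] with N hαN hmN hlt hpos
  have hlow := log_inv_le_mul_mixingTime (n := n N) hαN hmN hε0
  have hanti := mixingTime_anti (n N) (m N) hαN hδ0 (by linarith : δ ≤ 1 - ε)
  -- A zero denominator would make the ratio 0, yet it is eventually positive.
  have hden : 0 < mixingTime (distToEq (n N) (m N) (α N)) (1 - ε) := by
    refine lt_of_le_of_ne (mixingTime_nonneg _ _) fun h0 => ?_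
    rw [← h0, div_zero] at hpos
    exact lt_irrefl _ hpos
  rw [div_lt_iff₀ hden] at hlt
  have h3 := mul_le_mul_of_nonneg_left (hlt.le.trans (mul_le_mul_of_nonneg_left hanti two_pos.le))
    hαN.le
  linarith

end Cutoff

end Ehrenfest

theorem corollary1 (α : ℕ → ℝ) (m : ℕ → ℕ)
    (hα : ∀ N : ℕ, 2 ≤ N → 0 < α N ∧ α N < 1)
    (hm : ∀ N : ℕ, 2 ≤ N → 1 ≤ m N ∧ m N ≤ N - 1)
    (hγ : ∃ γ : ℝ, -1 ≤ γ ∧ γ ≤ 1 ∧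
      Tendsto (fun N : ℕ => Real.log (m N) / Real.log N - α N) atTop (𝓝 γ)) :
    (∀ N : ℕ, 2 ≤ N →
      Ehrenfest.relaxationTime (Ehrenfest.generator (N - m N) (m N) (α N)) = (α N)⁻¹) ∧
    (Ehrenfest.HasCutoff (fun N => Ehrenfest.distToEq (N - m N) (m N) (α N)) ↔
      Tendsto
        (fun N : ℕ =>
          Ehrenfest.mixingTime (Ehrenfest.distToEq (N - m N) (m N) (α N)) (1 / 4) /
            Ehrenfest.relaxationTime (Ehrenfest.generator (N - m N) (m N) (α N)))
        atTop atTop) := by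
  have hrel : ∀ N : ℕ, 2 ≤ N →
      Ehrenfest.relaxationTime (Ehrenfest.generator (N - m N) (m N) (α N)) = (α N)⁻¹ :=
    fun N hN => Ehrenfest.relaxationTime_generator (hα N hN).1 (hα N hN).2.le (hm N hN).1
  refine ⟨hrel, ?_⟩
  have hα' : ∀ᶠ N in atTop, 0 < α N ∧ α N ≤ 1 :=
    (eventually_ge_atTop 2).mono fun N hN => ⟨(hα N hN).1, (hα N hN).2.le⟩
  have hn' : ∀ᶠ N in atTop, 1 ≤ N - m N :=
    (eventually_ge_atTop 2).mono fun N hN => by have := hm N hN; omega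
  have hm' : ∀ᶠ N in atTop, 1 ≤ m N := (eventually_ge_atTop 2).mono fun N hN => (hm N hN).1
  have heq : (fun N : ℕ =>
        α N * Ehrenfest.mixingTime (Ehrenfest.distToEq (N - m N) (m N) (α N)) (1 / 4)) =ᶠ[atTop]
      fun N : ℕ => Ehrenfest.mixingTime (Ehrenfest.distToEq (N - m N) (m N) (α N)) (1 / 4) /
        Ehrenfest.relaxationTime (Ehrenfest.generator (N - m N) (m N) (α N)) := by
    filter_upwards [eventually_ge_atTop 2] with N hN
    rw [hrel N hN, div_inv_eq_mul, mul_comm]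
  rw [← tendsto_congr' heq]
  exact ⟨fun h => Ehrenfest.tendsto_mul_mixingTime_of_hasCutoff (n := fun N => N - m N)
      (hα'.mono fun _ h => h.1) hm' (by norm_num) (by norm_num) h,
    fun h => Ehrenfest.hasCutoff_of_tendsto_mul_mixingTime (n := fun N => N - m N)
      hα' hn' hm' (by norm_num) (by norm_num) h⟩
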